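/- An AW*-algebra is a C*-algebra $A$ in which the right annihilator $\{x\in A : sx=0 \text{ for all } s\in S\}$ of every subset $S\subseteq A$ has the form $pA$ for some projection $p=p^2=p^*\in A$. Projections are ordered by $e\le f$ if and only if $e=ef$; with this order they form a complete lattice, and for an orthogonal family $(e_i)_{i\in I}$ of projections (that is, $e_ie_j=0$ for $i\ne j$) the supremum is written $\sum_{i\in I}e_i$. For projections $e,f$ write $e\sim f$ if $e=vv^*$ and $f=v^*v$ for some $v\in A$, and $e\precsim f$ if $e\sim e'\le f$ for some projection $e'$. The central cover $C(e)$ of a projection $e$ is the least central projection $z$ with $e\le z$. A projection $e$ is properly infinite if $e\neq 0$ and $e=e_1+e_2$ for some projections $e_1\sim e_2\sim e$. For a properly infinite projection $e$, the dimension $d(e)$ is the least cardinal that is strictly greater than $|I|$ for every orthogonal family $(e_i)_{i\in I}$ of projections such that $e=\sum_{i\in I}e_i$ and $e_i\sim e$ for all $i\in I$. **Theorem.** Let $e$ and $f$ be properly infinite projections in an AW*-algebra $A$. If $C(e)=C(f)$ and $e\precsim f$, then $d(e)\le d(f)$. -/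

import Mathlib

universe u

namespace AWStar

/-- An AW*-algebra is a C*-algebra in which the right annihilator
`{x | ∀ s ∈ S, s * x = 0}` of every subset `S` is of the form `p * A` for a projection `p`.
(The case `S = ∅` forces a unit to exist, so it is no restriction to start from a unital
C*-algebra.) -/
class IsAWStarAlgebra (A : Type u) [CStarAlgebra A] : Prop where
  exists_annihilator_eq : ∀ S : Set A, ∃ p : A, IsStarProjection p ∧
    {x : A | ∀ s ∈ S, s * x = 0} = {x : A | ∃ a : A, x = p * a}

/-- The projections (self-adjoint idempotents) of a C*-algebra. -/
@[ext]
structure Proj (A : Type u) [CStarAlgebra A] where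
  val : A
  isStarProjection : IsStarProjection val

namespace Proj

variable {A : Type u} [CStarAlgebra A]

/-- Projections are ordered by `e ≤ f` if and only if `e = e * f`. -/
instance : PartialOrder (Proj A) where
  le e f := e.val = e.val * f.val
  le_refl e := e.isStarProjection.isIdempotentElem.symm
  le_trans e f g hef hfg := by
    change e.val = e.val * g.val
    change e.val = e.val * f.val at hef
    change f.val = f.val * g.val at hfg
    calc e.val = e.val * (f.val * g.val) := by rw [← hfg, ← hef]
      _ = e.val * g.val := by rw [← mul_assoc, ← hef]
  le_antisymm e f hef hfe := by
    change e.val = e.val * f.val at hef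
    change f.val = f.val * e.val at hfe
    ext
    calc e.val = star e.val := e.isStarProjection.isSelfAdjoint.star_eq.symm
      _ = star (e.val * f.val) := by rw [← hef]
      _ = f.val * e.val := by
        rw [star_mul, e.isStarProjection.isSelfAdjoint.star_eq,
          f.isStarProjection.isSelfAdjoint.star_eq]
      _ = f.val := hfe.symm

/-- Equivalence of projections: `e ∼ f` when `e = v v*` and `f = v* v` for some `v`. -/
def Equivalent (e f : Proj A) : Prop :=
  ∃ v : A, e.val = v * star v ∧ f.val = star v * v

/-- Subequivalence of projections: `e ≾ f` when `e ∼ e' ≤ f` for some projection `e'`. -/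
def Subequivalent (e f : Proj A) : Prop :=
  ∃ e' : Proj A, Equivalent e e' ∧ e' ≤ f

/-- A projection is central when it commutes with all elements of the algebra. -/
def IsCentral (z : Proj A) : Prop :=
  ∀ a : A, z.val * a = a * z.val

/-- In an AW*-algebra there is a least central projection above any given projection. -/
theorem exists_isLeast_central [IsAWStarAlgebra A] (e : Proj A) :
    ∃ z : Proj A, IsLeast {z : Proj A | IsCentral z ∧ e ≤ z} z := by
  obtain ⟨p, hp, hS⟩ :=
    IsAWStarAlgebra.exists_annihilator_eq {s : A | ∃ b : A, s = e.val * b}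
  have hpp : p * p = p := hp.isIdempotentElem
  have hps : star p = p := hp.isSelfAdjoint.star_eq
  have key : ∀ x : A, (∀ b : A, e.val * b * x = 0) ↔ ∃ a : A, x = p * a := by
    intro x
    have h := Set.ext_iff.mp hS x
    simp only [Set.mem_setOf_eq] at h
    rw [← h]
    exact ⟨fun h' s ⟨b, hb⟩ => hb ▸ h' b, fun h' b => h' _ ⟨b, rfl⟩⟩
  have hp0 : ∀ b : A, e.val * b * p = 0 := (key p).mpr ⟨1, (mul_one p).symm⟩
  have h1 : ∀ a : A, p * (a * p) = a * p := by
    intro a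
    obtain ⟨c, hc⟩ := (key (a * p)).mp fun b => by
      rw [← mul_assoc, mul_assoc e.val b a]; exact hp0 (b * a)
    rw [hc, ← mul_assoc, hpp]
  have h2 : ∀ a : A, p * a * p = p * a := by
    intro a
    have h := congrArg star (h1 (star a))
    simpa [star_mul, hps, mul_assoc] using h
  have hcomm : ∀ a : A, p * a = a * p := fun a => by rw [← h2 a, mul_assoc, h1 a]
  refine ⟨⟨1 - p, hp.one_sub⟩, ⟨fun a => ?_, ?_⟩, ?_⟩
  · change (1 - p) * a = a * (1 - p)
    rw [sub_mul, mul_sub, one_mul, mul_one, hcomm a]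
  · change e.val = e.val * (1 - p)
    have h := hp0 1
    rw [mul_one] at h
    rw [mul_sub, mul_one, h, sub_zero]
  · rintro w ⟨hw, hew⟩
    change e.val = e.val * w.val at hew
    change (1 - p) = (1 - p) * w.val
    obtain ⟨c, hc⟩ := (key (1 - w.val)).mp fun b => by
      have hb : b * (1 - w.val) = (1 - w.val) * b := by
        rw [sub_mul, mul_sub, one_mul, mul_one, hw b]
      rw [mul_assoc, hb, ← mul_assoc, mul_sub, mul_one, ← hew, sub_self, zero_mul]
    have h3 : p * (1 - w.val) = 1 - w.val := by rw [hc, ← mul_assoc, hpp]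
    have h4 : (1 - p) * (1 - w.val) = 0 := by rw [sub_mul, one_mul, h3, sub_self]
    rw [mul_sub, mul_one] at h4
    exact sub_eq_zero.mp h4

/-- The central cover of a projection: the least central projection above it. -/
noncomputable def centralCover [IsAWStarAlgebra A] (e : Proj A) : Proj A :=
  (exists_isLeast_central e).choose

theorem isLeast_centralCover [IsAWStarAlgebra A] (e : Proj A) :
    IsLeast {z : Proj A | IsCentral z ∧ e ≤ z} (centralCover e) :=
  (exists_isLeast_central e).choose_spec

/-- A projection `e` is properly infinite when it is nonzero and there are projections
`e₁ ∼ e₂ ∼ e` such that `e = e₁ + e₂`. (The two summands are then orthogonal.) -/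
def ProperlyInfinite (e : Proj A) : Prop :=
  e.val ≠ 0 ∧ ∃ e₁ e₂ : Proj A,
    Equivalent e₁ e₂ ∧ Equivalent e₂ e ∧ e.val = e₁.val + e₂.val

/-- `IsDecomposition e p` says that `p` is an orthogonal family of projections, each equivalent
to `e`, with `e = ∑ p i`; the sum of an orthogonal family is its supremum in the ordered set of
all projections. -/
structure IsDecomposition (e : Proj A) {I : Type u} (p : I → Proj A) : Prop where
  orthogonal : ∀ i j : I, i ≠ j → (p i).val * (p j).val = 0
  isLUB : IsLUB (Set.range p) e
  equivalent : ∀ i : I, Equivalent (p i) e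

/-- The cardinalities of the index sets of the decompositions of `e`. Index sets from the universe
of the algebra suffice, as the members of a decomposition of a nonzero projection are distinct. -/
def decompositionCards (e : Proj A) : Set Cardinal.{u} :=
  {c | ∃ (I : Type u) (p : I → Proj A), IsDecomposition e p ∧ c = Cardinal.mk I}

open Classical in
/-- The dimension `d(e)`: the least cardinal strictly greater than the cardinality of every
decomposition of `e`, with the convention `d(0) = 0`. -/
noncomputable def dim (e : Proj A) : Cardinal.{u} :=
  if e.val = 0 then 0 else sInf {c : Cardinal.{u} | ∀ a ∈ decompositionCards e, a < c}

/-- The least cardinal in the definition of the dimension exists. -/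
theorem isLeast_dim (e : Proj A) (he : e.val ≠ 0) :
    IsLeast {c : Cardinal.{u} | ∀ a ∈ decompositionCards e, a < c} (dim e) := by
  have hne : {c : Cardinal.{u} | ∀ a ∈ decompositionCards e, a < c}.Nonempty := by
    refine ⟨Order.succ (Cardinal.mk (Proj A)), ?_⟩
    rintro _ ⟨I, p, hp, rfl⟩
    refine Order.lt_succ_of_le (Cardinal.mk_le_of_injective (f := p) fun i j hij => ?_)
    by_contra hne
    have h0 : (p i).val = 0 := by
      have h := hp.orthogonal i j hne
      rw [← hij] at h
      exact (p i).isStarProjection.isIdempotentElem.symm.trans h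
    obtain ⟨v, hv, hv'⟩ := hp.equivalent i
    apply he
    calc e.val = e.val * e.val := e.isStarProjection.isIdempotentElem.symm
      _ = star v * (v * star v) * v := by rw [hv']; simp only [mul_assoc]
      _ = 0 := by rw [← hv, h0, mul_zero, zero_mul]
  rw [dim, if_neg he]
  exact ⟨csInf_mem hne, fun c hc => csInf_le' hc⟩

end Proj

end AWStar

namespace AWStar

namespace Proj

variable {A : Type u} [CStarAlgebra A]

/-! ### Algebra of projections -/

/-! Say that `f` is `I`-divisible when it is the sum of copies of itself indexed by `I`. It suffices
that every index set `I` dividing `e` also divides `f`. The empty set cannot divide a nonzero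
projection and a singleton divides everything, so let `I` have at least two elements. Replace `e` by
an equivalent `e' ≤ f`, and let `g` be the supremum of a maximal orthogonal family of `I`-divisible
projections below `f`. Summing index by index shows that `g` is itself `I`-divisible
(`Divisible.of_isLUB`).

Generalized comparability (`exists_isCentral_subequivalent`) gives a central `z` with `zg ≾ f - g`
and `(1 - z)(f - g) ≾ g`. The copy of `zg` under `f - g` is divisible, so maximality forces `zg =
0`. Then `ze'` is divisible and orthogonal to `g`, hence zero, and equality of central covers gives
`zf = 0`. Thus `f - g ≾ g`. Since `g` contains two orthogonal copies of itself, `f ≾ g`, and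
Schröder–Bernstein gives `g ∼ f`.

The analytic inputs are additivity of equivalence below a properly infinite projection
(`equivalent_of_isLUB`) and the existence of equivalent subprojections whenever `eAf ≠ 0`
(`exists_equivalent_of_mul_ne_zero`). -/

@[simp]
theorem mul_self (e : Proj A) : e.val * e.val = e.val :=
  e.isStarProjection.isIdempotentElem

@[simp]
theorem mul_self_assoc (e : Proj A) (a : A) : e.val * (e.val * a) = e.val * a := by
  rw [← mul_assoc, mul_self]

@[simp]
theorem star_val (e : Proj A) : star e.val = e.val :=
  e.isStarProjection.isSelfAdjoint.star_eq

theorem le_iff_mul_right {e f : Proj A} : e ≤ f ↔ e.val * f.val = e.val :=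
  eq_comm

theorem le_iff_mul_left {e f : Proj A} : e ≤ f ↔ f.val * e.val = e.val := by
  rw [le_iff_mul_right]
  constructor <;> intro h <;> simpa using congrArg star h

theorem mul_eq_zero_comm {e f : Proj A} : e.val * f.val = 0 ↔ f.val * e.val = 0 := by
  constructor <;> intro h <;> simpa using congrArg star h

theorem mul_eq_zero_of_le {e f e' f' : Proj A} (h : e.val * f.val = 0) (he : e' ≤ e)
    (hf : f' ≤ f) : e'.val * f'.val = 0 := by
  rw [← le_iff_mul_right.1 he, ← le_iff_mul_left.1 hf, mul_assoc, ← mul_assoc e.val, h,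
    zero_mul, mul_zero]

/-- The orthogonal complement of a projection. -/
def compl (e : Proj A) : Proj A := ⟨1 - e.val, e.isStarProjection.one_sub⟩

@[simp]
theorem compl_val (e : Proj A) : e.compl.val = 1 - e.val := rfl

theorem le_compl_iff {e f : Proj A} : e ≤ f.compl ↔ f.val * e.val = 0 := by
  rw [le_iff_mul_left, compl_val, sub_mul, one_mul, sub_eq_self]

/-- The difference of two comparable projections. -/
def diff (f e : Proj A) (h : e ≤ f) : Proj A :=
  ⟨f.val - e.val, e.isStarProjection.sub_of_mul_eq_left f.isStarProjection (le_iff_mul_right.1 h)⟩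

@[simp]
theorem diff_val {e f : Proj A} (h : e ≤ f) : (f.diff e h).val = f.val - e.val := rfl

theorem diff_le {e f : Proj A} (h : e ≤ f) : f.diff e h ≤ f := by
  rw [le_iff_mul_left, diff_val, mul_sub, mul_self, le_iff_mul_left.1 h]

theorem diff_mul_self {e f : Proj A} (h : e ≤ f) : (f.diff e h).val * e.val = 0 := by
  rw [diff_val, sub_mul, mul_self, le_iff_mul_left.1 h, sub_self]

/-- The sum of two orthogonal projections. -/
def add (e f : Proj A) (h : e.val * f.val = 0) : Proj A :=
  ⟨e.val + f.val, e.isStarProjection.add f.isStarProjection h⟩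

@[simp]
theorem add_val {e f : Proj A} (h : e.val * f.val = 0) : (e.add f h).val = e.val + f.val := rfl

/-- The product of a projection with a central projection. -/
def cut (z : Proj A) (hz : z.IsCentral) (e : Proj A) : Proj A :=
  ⟨z.val * e.val, z.isStarProjection.mul e.isStarProjection (hz e.val)⟩

@[simp]
theorem cut_val {z : Proj A} (hz : z.IsCentral) (e : Proj A) :
    (z.cut hz e).val = z.val * e.val := rfl

theorem cut_le {z : Proj A} (hz : z.IsCentral) (e : Proj A) : z.cut hz e ≤ e := by
  rw [le_iff_mul_right, cut_val, mul_assoc, mul_self]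

theorem IsCentral.compl {z : Proj A} (hz : z.IsCentral) : z.compl.IsCentral := fun a => by
  rw [compl_val, sub_mul, mul_sub, one_mul, mul_one, hz a]

/-- The projection `v e v*` for a projection `e` below the initial projection of `v`. -/
def conj (v : A) (e : Proj A) (h : star v * v * e.val = e.val) : Proj A where
  val := v * e.val * star v
  isStarProjection :=
    ⟨by
      change v * e.val * star v * (v * e.val * star v) = v * e.val * star v
      calc _ = v * (e.val * (star v * v * e.val)) * star v := by simp only [mul_assoc]
        _ = _ := by rw [h, mul_self],
    by simp [IsSelfAdjoint, mul_assoc]⟩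

@[simp]
theorem conj_val {v : A} {e : Proj A} (h : star v * v * e.val = e.val) :
    (conj v e h).val = v * e.val * star v := rfl

theorem conj_equivalent {v : A} {e : Proj A} (h : star v * v * e.val = e.val) :
    Equivalent (conj v e h) e := by
  refine ⟨v * e.val, ?_, ?_⟩
  · simp [mul_assoc]
  · rw [star_mul, star_val, mul_assoc, ← mul_assoc (star v), h, mul_self]

theorem conj_mul_conj {v : A} {e f : Proj A} (he : star v * v * e.val = e.val)
    (hf : star v * v * f.val = f.val) :
    (conj v e he).val * (conj v f hf).val = v * (e.val * f.val) * star v := by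
  calc _ = v * (e.val * (star v * v * f.val)) * star v := by simp only [conj_val, mul_assoc]
    _ = _ := by rw [hf]

theorem conj_mul_conj_eq_zero {v : A} {e f : Proj A} (he : star v * v * e.val = e.val)
    (hf : star v * v * f.val = f.val) (h : e.val * f.val = 0) :
    (conj v e he).val * (conj v f hf).val = 0 := by
  rw [conj_mul_conj, h, mul_zero, zero_mul]

theorem conj_mono {v : A} {e f : Proj A} (he : star v * v * e.val = e.val)
    (hf : star v * v * f.val = f.val) (h : e ≤ f) : conj v e he ≤ conj v f hf := by
  rw [le_iff_mul_left, conj_mul_conj, le_iff_mul_left.1 h, conj_val]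

/-! ### Equivalence of projections -/

/-- By the C*-identity: `(ev - v)(ev - v)*` expands to `e - e - e + e = 0`. -/
theorem val_mul_of_eq {e : Proj A} {v : A} (h : e.val = v * star v) : e.val * v = v := by
  rw [← sub_eq_zero, ← CStarRing.mul_star_self_eq_zero_iff]
  simp only [star_sub, star_mul, star_val, sub_mul, mul_sub]
  simp only [mul_assoc]
  rw [← mul_assoc v (star v) e.val, ← h]
  simp

theorem mul_val_of_eq {f : Proj A} {v : A} (h : f.val = star v * v) : v * f.val = v := by
  have := val_mul_of_eq (e := f) (v := star v) (by rw [h, star_star])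
  simpa using congrArg star this

/-- The range projection of a partial isometry. -/
theorem exists_equivalent_of_star_mul_self {f : Proj A} {v : A} (h : f.val = star v * v) :
    ∃ e : Proj A, e.val = v * star v ∧ Equivalent e f := by
  have h1 : star v * v * f.val = f.val := by rw [← h, mul_self]
  have h2 : (conj v f h1).val = v * star v := by rw [conj_val, mul_val_of_eq h]
  exact ⟨conj v f h1, h2, v, h2, h⟩

theorem Equivalent.refl (e : Proj A) : Equivalent e e := ⟨e.val, by simp, by simp⟩

theorem Equivalent.symm {e f : Proj A} (h : Equivalent e f) : Equivalent f e := by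
  obtain ⟨v, h1, h2⟩ := h
  exact ⟨star v, by rw [star_star, h2], by rw [star_star, h1]⟩

theorem Equivalent.trans {e f g : Proj A} (h : Equivalent e f) (h' : Equivalent f g) :
    Equivalent e g := by
  obtain ⟨v, h1, h2⟩ := h
  obtain ⟨w, h3, h4⟩ := h'
  refine ⟨v * w, ?_, ?_⟩
  · calc e.val = v * f.val * star v := by rw [mul_val_of_eq h2, h1]
      _ = _ := by rw [h3]; simp only [star_mul, mul_assoc]
  · calc g.val = star w * (f.val * w) := by rw [val_mul_of_eq h3, h4]
      _ = _ := by rw [h2]; simp only [star_mul, mul_assoc]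

theorem Equivalent.cut {e f z : Proj A} (h : Equivalent e f) (hz : z.IsCentral) :
    Equivalent (z.cut hz e) (z.cut hz f) := by
  obtain ⟨v, h1, h2⟩ := h
  refine ⟨z.val * v, ?_, ?_⟩
  · rw [star_mul, star_val, cut_val, h1, ← hz (star v), mul_assoc, ← mul_assoc v, ← hz v]
    simp [mul_assoc]
  · rw [star_mul, star_val, cut_val, h2, ← hz (star v), mul_assoc, ← mul_assoc (star v),
      ← hz (star v), mul_assoc, mul_self_assoc]

theorem Equivalent.add {e f e' f' : Proj A} (h : Equivalent e e') (h' : Equivalent f f')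
    (hef : e.val * f.val = 0) (hef' : e'.val * f'.val = 0) :
    Equivalent (e.add f hef) (e'.add f' hef') := by
  obtain ⟨v, h1, h2⟩ := h
  obtain ⟨w, h3, h4⟩ := h'
  have key : ∀ {a b : Proj A} {x y : A}, a.val * b.val = 0 → a.val = star x * x →
      b.val = star y * y → x * star y = 0 := fun {a b x y} hab ha hb => by
    rw [← mul_val_of_eq ha, ← mul_val_of_eq hb, star_mul, star_val, mul_assoc,
      ← mul_assoc a.val, hab, zero_mul, mul_zero]
  have h5 : v * star w = 0 := key hef' h2 h4
  have h6 : w * star v = 0 := key (mul_eq_zero_comm.1 hef') h4 h2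
  have h7 : star v * w = 0 := by
    simpa using key (x := star v) (y := star w) hef (by rw [star_star, h1]) (by rw [star_star, h3])
  have h8 : star w * v = 0 := by simpa using congrArg star h7
  refine ⟨v + w, ?_, ?_⟩
  · rw [add_val, star_add, add_mul, mul_add, mul_add, h5, h6, h1, h3]; simp
  · rw [add_val, star_add, add_mul, mul_add, mul_add, h7, h8, h2, h4]; simp

theorem Equivalent.val_eq_zero {e f : Proj A} (h : Equivalent e f) (he : e.val = 0) :
    f.val = 0 := by
  obtain ⟨v, h1, h2⟩ := h
  rw [← mul_self, h2, ← mul_assoc, mul_assoc (star v), ← h1, he, mul_zero, zero_mul]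

/-- The projection onto the graph of a partial isometry between orthogonal projections. -/
theorem exists_graph {e f : Proj A} {w : A} (hef : e.val * f.val = 0) (h1 : e.val = w * star w)
    (h2 : f.val = star w * w) :
    ∃ r : Proj A, (2 : A) * r.val = e.val + f.val + w + star w := by
  have hew := val_mul_of_eq h1
  have hwf := mul_val_of_eq h2
  have hfe := mul_eq_zero_comm.1 hef
  have hwe : star w * e.val = star w := by simpa using congrArg star hew
  have hfw : f.val * star w = star w := by simpa using congrArg star hwf
  have hfw' : f.val * w = 0 := by rw [← hew, ← mul_assoc, hfe, zero_mul]
  have hwe' : w * e.val = 0 := by rw [← hwf, mul_assoc, hfe, mul_zero]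
  have hew' : e.val * star w = 0 := by simpa using congrArg star hwe'
  have hwf' : star w * f.val = 0 := by simpa using congrArg star hfw'
  have hww : w * w = 0 := by
    calc w * w = w * (e.val * w) := by rw [hew]
      _ = 0 := by rw [← mul_assoc, hwe', zero_mul]
  have hww' : star w * star w = 0 := by simpa using congrArg star hww
  set s : A := e.val + f.val + w + star w with hs
  -- In block form `s` is the matrix with rows `(e, w)` and `(w*, f)`; its square is twice itself,
  -- so half of it is a projection.
  have hss : s * s = (2 : ℝ) • s := by
    simp only [hs, mul_add, add_mul, mul_self, hef, hfe, hew, hwf, hwe, hfw, hfw', hwe', hew',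
      hwf', hww, hww', ← h1, ← h2, two_smul]
    abel
  refine ⟨⟨(1 / 2 : ℝ) • s, ?_, ?_⟩, ?_⟩
  · change ((1 / 2 : ℝ) • s) * ((1 / 2 : ℝ) • s) = _
    rw [smul_mul_smul_comm, hss, smul_smul]
    norm_num
  · change star ((1 / 2 : ℝ) • s) = _
    simp only [hs, star_smul, star_add, star_val, star_star, star_trivial]
    congr 1
    abel
  · change (2 : A) * ((1 / 2 : ℝ) • s) = s
    rw [two_mul, ← add_smul]
    norm_num

theorem ProperlyInfinite.exists_orthogonal_copies {f : Proj A} (hf : f.ProperlyInfinite) :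
    ∃ f₁ f₂ : Proj A, Equivalent f₁ f ∧ Equivalent f₂ f ∧ f₁.val * f₂.val = 0 := by
  obtain ⟨-, f₁, f₂, h12, h2, h⟩ := hf
  refine ⟨f₁, f₂, h12.trans h2, h2, ?_⟩
  have h3 := f.mul_self
  rw [h] at h3
  -- A sum of two projections is idempotent only if they anticommute. Multiplying by `f₁` on either
  -- side shows that they also commute, so the product vanishes.
  have h4 : f₁.val * f₂.val + f₂.val * f₁.val = 0 := by
    simp only [mul_add, add_mul, mul_self] at h3
    rw [← sub_eq_zero] at h3
    rw [← h3]
    abel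
  have h5 : f₁.val * f₂.val + f₁.val * f₂.val * f₁.val = 0 := by
    have := congrArg (f₁.val * ·) h4
    simpa [mul_add, mul_assoc] using this
  have h6 : f₁.val * f₂.val * f₁.val + f₂.val * f₁.val = 0 := by
    have := congrArg (· * f₁.val) h4
    simpa [add_mul, mul_assoc] using this
  have h7 : f₁.val * f₂.val = f₂.val * f₁.val :=
    (eq_neg_of_add_eq_zero_left h5).trans (neg_eq_of_add_eq_zero_right h6)
  rw [← h7, ← two_smul ℝ] at h4
  exact (smul_eq_zero.1 h4).resolve_left two_ne_zero

/-! ### Decompositions -/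

/-- `e` has a decomposition indexed by `I`. -/
def Divisible (I : Type u) (e : Proj A) : Prop := ∃ p : I → Proj A, IsDecomposition e p

theorem divisible_of_subsingleton {I : Type u} [Nonempty I] [Subsingleton I] (f : Proj A) :
    Divisible I f :=
  ⟨fun _ => f, fun i j hij => (hij (Subsingleton.elim i j)).elim, by simp,
    fun _ => Equivalent.refl f⟩

/-! ### Suprema -/

variable [IsAWStarAlgebra A]

/-- The right annihilator of `S` is generated by a projection. -/
theorem exists_annihilator (S : Set A) :
    ∃ q : Proj A, ∀ x : A, (∀ s ∈ S, s * x = 0) ↔ q.val * x = x := by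
  obtain ⟨q, hq, h⟩ := IsAWStarAlgebra.exists_annihilator_eq S
  refine ⟨⟨q, hq⟩, fun x => (Set.ext_iff.1 h x).trans ⟨?_, fun hx => ⟨x, hx.symm⟩⟩⟩
  rintro ⟨a, rfl⟩
  rw [← mul_assoc, hq.isIdempotentElem.eq]

/-- Right annihilators are generated by projections, so `a` kills every `p i` exactly when all of
them lie below the generator of the annihilator of `a`. This turns order statements about suprema
into algebraic identities. -/
theorem isLUB_iff {ι : Sort*} {p : ι → Proj A} {e : Proj A} :
    IsLUB (Set.range p) e ↔
      (∀ i, p i ≤ e) ∧ ∀ a : A, (∀ i, a * (p i).val = 0) → a * e.val = 0 := by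
  constructor
  · intro h
    refine ⟨fun i => h.1 ⟨i, rfl⟩, fun a ha => ?_⟩
    obtain ⟨q, hq⟩ := exists_annihilator {a}
    simp only [Set.mem_singleton_iff, forall_eq] at hq
    have : e ≤ q := h.2 (by
      rintro _ ⟨i, rfl⟩
      exact le_iff_mul_left.2 ((hq _).1 (ha i)))
    exact (hq _).2 (le_iff_mul_left.1 this)
  · rintro ⟨h1, h2⟩
    refine ⟨by rintro _ ⟨i, rfl⟩; exact h1 i, fun b hb => ?_⟩
    have := h2 (1 - b.val) fun i => by
      rw [sub_mul, one_mul, le_iff_mul_left.1 (hb ⟨i, rfl⟩), sub_self]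
    rw [sub_mul, one_mul, sub_eq_zero] at this
    exact le_iff_mul_left.2 this.symm

theorem exists_isLUB {ι : Sort*} (p : ι → Proj A) : ∃ e, IsLUB (Set.range p) e := by
  obtain ⟨q, hq⟩ := exists_annihilator (Set.range fun i => (p i).val)
  simp only [Set.forall_mem_range] at hq
  refine ⟨q.compl, isLUB_iff.2 ⟨fun i => ?_, fun a ha => ?_⟩⟩
  · rw [le_compl_iff, mul_eq_zero_comm]
    exact (hq _).2 q.mul_self i
  · have h1 : ∀ i, (p i).val * star a = 0 := fun i => by
      simpa using congrArg star (ha i)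
    have h2 := congrArg star ((hq _).1 h1)
    simp only [star_mul, star_star, star_val] at h2
    rw [compl_val, mul_sub, mul_one, h2, sub_self]

theorem mul_eq_zero_of_isLUB {ι κ : Sort*} {p : ι → Proj A} {q : κ → Proj A} {e f : Proj A}
    (he : IsLUB (Set.range p) e) (hf : IsLUB (Set.range q) f)
    (h : ∀ i j, (p i).val * (q j).val = 0) : e.val * f.val = 0 := by
  refine (isLUB_iff.1 hf).2 _ fun j => ?_
  rw [mul_eq_zero_comm]
  refine (isLUB_iff.1 he).2 _ fun i => ?_
  rw [mul_eq_zero_comm]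
  exact h i j

theorem isLUB_conj {ι : Sort*} {v : A} {p : ι → Proj A} {e : Proj A}
    (hp : ∀ i, star v * v * (p i).val = (p i).val) (he : star v * v * e.val = e.val)
    (h : IsLUB (Set.range p) e) :
    IsLUB (Set.range fun i => conj v (p i) (hp i)) (conj v e he) := by
  rw [isLUB_iff] at h ⊢
  refine ⟨fun i => conj_mono _ _ (h.1 i), fun a ha => ?_⟩
  have : a * v * e.val = 0 := h.2 _ fun i => by
    calc a * v * (p i).val = a * v * (p i).val * (star v * v * (p i).val) := by
          rw [hp]; simp [mul_assoc]
      _ = a * (conj v (p i) (hp i)).val * v * (p i).val := by simp only [conj_val, mul_assoc]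
      _ = 0 := by rw [ha]; simp
  rw [conj_val, ← mul_assoc, ← mul_assoc, this, zero_mul]

theorem isLUB_cut {ι : Sort*} {z : Proj A} (hz : z.IsCentral) {p : ι → Proj A} {e : Proj A}
    (h : IsLUB (Set.range p) e) : IsLUB (Set.range fun i => z.cut hz (p i)) (z.cut hz e) := by
  rw [isLUB_iff] at h ⊢
  refine ⟨fun i => ?_, fun a ha => ?_⟩
  · rw [le_iff_mul_left, cut_val, cut_val, mul_assoc, ← mul_assoc e.val, ← hz e.val, mul_assoc,
      mul_self_assoc, le_iff_mul_left.1 (h.1 i)]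
  · rw [cut_val, ← mul_assoc]
    exact h.2 _ fun i => by rw [mul_assoc]; exact ha i

/-! ### Additivity of equivalence -/

/-- The partial isometries `w i` cannot be summed directly, but projections have suprema. Each `w i`
is encoded by its graph projection `r i`, and the sum is read off as an off-diagonal corner of the
supremum `R`. -/
theorem equivalent_of_isLUB_of_orthogonal {ι : Type*} {p q : ι → Proj A} {e f : Proj A}
    (hp : Pairwise fun i j => (p i).val * (p j).val = 0)
    (hq : Pairwise fun i j => (q i).val * (q j).val = 0)
    (he : IsLUB (Set.range p) e) (hf : IsLUB (Set.range q) f)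
    (hpq : ∀ i, Equivalent (p i) (q i)) (hef : e.val * f.val = 0) : Equivalent e f := by
  choose w hw1 hw2 using hpq
  have hpe := (isLUB_iff.1 he).1
  have hqf := (isLUB_iff.1 hf).1
  have hpq : ∀ i j, (p i).val * (q j).val = 0 := fun i j =>
    mul_eq_zero_of_le hef (hpe i) (hqf j)
  have hqp : ∀ i j, (q i).val * (p j).val = 0 := fun i j => mul_eq_zero_comm.1 (hpq j i)
  choose r hr using fun i => exists_graph (hpq i i) (hw1 i) (hw2 i)
  have hpw := fun i => val_mul_of_eq (hw1 i)
  have hwq := fun i => mul_val_of_eq (hw2 i)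
  have hqw : ∀ i, (q i).val * star (w i) = star (w i) := fun i => by
    simpa using congrArg star (hwq i)
  have hwp : ∀ i, star (w i) * (p i).val = star (w i) := fun i => by
    simpa using congrArg star (hpw i)
  have hwe : ∀ i, w i * e.val = 0 := fun i => by
    rw [← hwq i, mul_assoc, ← le_iff_mul_right.1 (hqf i), mul_assoc (q i).val,
      mul_eq_zero_comm.1 hef, mul_zero, mul_zero]
  have hwf : ∀ i, star (w i) * f.val = 0 := fun i => by
    rw [← hwp i, mul_assoc, ← le_iff_mul_right.1 (hpe i), mul_assoc (p i).val, hef, mul_zero,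
      mul_zero]
  have hwf' : ∀ i, w i * f.val = w i := fun i => by
    rw [← hwq i, mul_assoc, le_iff_mul_right.1 (hqf i)]
  have hwe' : ∀ i, star (w i) * e.val = star (w i) := fun i => by
    rw [← hwp i, mul_assoc, le_iff_mul_right.1 (hpe i)]
  have two_inj : ∀ x : A, 2 * x = 0 → x = 0 := fun x hx => by
    rw [two_mul, ← two_smul ℝ] at hx
    exact (smul_eq_zero.1 hx).resolve_left two_ne_zero
  have hpr : ∀ i, 2 * ((p i).val * (r i).val) = (p i).val + w i := fun i => by
    rw [two_mul, ← mul_add, ← two_mul, hr]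
    have : (p i).val * star (w i) = 0 := by rw [← hqw, ← mul_assoc, hpq, zero_mul]
    simp [mul_add, hpq, hpw, this]
  have hqr : ∀ i, 2 * ((q i).val * (r i).val) = (q i).val + star (w i) := fun i => by
    rw [two_mul, ← mul_add, ← two_mul, hr]
    have : (q i).val * w i = 0 := by rw [← hpw, ← mul_assoc, hqp, zero_mul]
    simp [mul_add, hqp, hqw, this]
  have hpr' : ∀ i j, i ≠ j → (p i).val * (r j).val = 0 := fun i j hij => two_inj _ <| by
    rw [two_mul, ← mul_add, ← two_mul, hr]
    have h1 : (p i).val * star (w j) = 0 := by rw [← hqw, ← mul_assoc, hpq, zero_mul]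
    have h2 : (p i).val * w j = 0 := by rw [← hpw, ← mul_assoc, hp hij, zero_mul]
    simp [mul_add, hpq, hp hij, h1, h2]
  have hqr' : ∀ i j, i ≠ j → (q i).val * (r j).val = 0 := fun i j hij => two_inj _ <| by
    rw [two_mul, ← mul_add, ← two_mul, hr]
    have h1 : (q i).val * star (w j) = 0 := by rw [← hqw, ← mul_assoc, hq hij, zero_mul]
    have h2 : (q i).val * w j = 0 := by rw [← hpw, ← mul_assoc, hqp, zero_mul]
    simp [mul_add, hqp, hq hij, h1, h2]
  have hrr : ∀ i j, i ≠ j → (r i).val * (r j).val = 0 := fun i j hij => two_inj _ <| by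
    have h1 : star (w i) * (r j).val = 0 := by rw [← hwp, mul_assoc, hpr' i j hij, mul_zero]
    have h2 : w i * (r j).val = 0 := by rw [← hwq, mul_assoc, hqr' i j hij, mul_zero]
    rw [← mul_assoc, hr]
    simp [add_mul, hpr' i j hij, hqr' i j hij, h1, h2]
  obtain ⟨R, hR⟩ := exists_isLUB r
  rw [isLUB_iff] at hR
  -- The element `x(1 - r i)` kills every `r j`, hence kills `R`; so such an `x` sees only the
  -- `i`-th graph.
  have key : ∀ (x : Proj A) (i : ι), (∀ j, i ≠ j → x.val * (r j).val = 0) →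
      x.val * R.val = x.val * (r i).val := fun x i hx => by
    have h := hR.2 (x.val * (1 - (r i).val)) fun j => by
      by_cases hij : i = j
      · subst hij; simp [mul_assoc, sub_mul]
      · rw [mul_assoc, sub_mul, one_mul, hrr i j hij, sub_zero, hx j hij]
    rw [mul_assoc, sub_mul, one_mul, le_iff_mul_right.1 (hR.1 i), mul_sub, sub_eq_zero] at h
    exact h
  have hpR : ∀ i, 2 * ((p i).val * R.val) = (p i).val + w i := fun i => by
    rw [key (p i) i (hpr' i), hpr]
  have hqR : ∀ i, 2 * ((q i).val * R.val) = (q i).val + star (w i) := fun i => by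
    rw [key (q i) i (hqr' i), hqr]
  -- Graph projections carry `w i / 2` off the diagonal, hence the factor 2.
  set W : A := 2 * (e.val * R.val * f.val) with hW
  have hW' : star W = 2 * (f.val * R.val * e.val) := by
    simp [hW, two_mul, mul_assoc]
  have hpW : ∀ i, (p i).val * W = w i := fun i => by
    calc (p i).val * W = 2 * ((p i).val * e.val * R.val) * f.val := by
          simp only [hW, two_mul, mul_add, add_mul, mul_assoc]
      _ = w i := by
          rw [le_iff_mul_right.1 (hpe i), hpR, add_mul, hwf',
            mul_eq_zero_of_le hef (hpe i) le_rfl, zero_add]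
  have hqW : ∀ i, (q i).val * star W = star (w i) := fun i => by
    calc (q i).val * star W = 2 * ((q i).val * f.val * R.val) * e.val := by
          simp only [hW', two_mul, mul_add, add_mul, mul_assoc]
      _ = star (w i) := by
          rw [le_iff_mul_right.1 (hqf i), hqR, add_mul, hwe',
            mul_eq_zero_of_le (mul_eq_zero_comm.1 hef) (hqf i) le_rfl, zero_add]
  have hWp : ∀ i, star W * (p i).val = star (w i) := fun i => by
    simpa using congrArg star (hpW i)
  have hWq : ∀ i, W * (q i).val = w i := fun i => by
    simpa using congrArg star (hqW i)
  refine ⟨W, ?_, ?_⟩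
  · have h := (isLUB_iff.1 he).2 (W * star W - e.val) fun i => by
      rw [sub_mul, mul_assoc, hWp, le_iff_mul_left.1 (hpe i), ← hqw, ← mul_assoc, hWq,
        ← hw1, sub_self]
    have hWe : star W * e.val = star W := by simp [hW', mul_assoc]
    rw [sub_mul, mul_assoc, hWe, mul_self, sub_eq_zero] at h
    exact h.symm
  · have h := (isLUB_iff.1 hf).2 (star W * W - f.val) fun i => by
      rw [sub_mul, mul_assoc, hWq, le_iff_mul_left.1 (hqf i), ← hpw, ← mul_assoc, hWp,
        ← hw2, sub_self]
    have hWf : W * f.val = W := by simp [hW, mul_assoc]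
    rw [sub_mul, mul_assoc, hWf, mul_self, sub_eq_zero] at h
    exact h.symm

/-- Equivalence is additive below a properly infinite projection. -/
theorem equivalent_of_isLUB {ι : Type*} {f : Proj A} (hf : f.ProperlyInfinite)
    {p q : ι → Proj A} {e g : Proj A} (hef : e ≤ f) (hgf : g ≤ f)
    (hp : Pairwise fun i j => (p i).val * (p j).val = 0)
    (hq : Pairwise fun i j => (q i).val * (q j).val = 0)
    (he : IsLUB (Set.range p) e) (hg : IsLUB (Set.range q) g)
    (hpq : ∀ i, Equivalent (p i) (q i)) : Equivalent e g := by
  obtain ⟨f₁, f₂, ⟨v, hv1, hv2⟩, ⟨w, hw1, hw2⟩, h12⟩ := hf.exists_orthogonal_copies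
  have hv : ∀ x : Proj A, x ≤ f → star v * v * x.val = x.val := fun x hx => by
    rw [← hv2, le_iff_mul_left.1 hx]
  have hw : ∀ x : Proj A, x ≤ f → star w * w * x.val = x.val := fun x hx => by
    rw [← hw2, le_iff_mul_left.1 hx]
  have hpf : ∀ i, p i ≤ f := fun i => (he.1 ⟨i, rfl⟩).trans hef
  have hqf : ∀ i, q i ≤ f := fun i => (hg.1 ⟨i, rfl⟩).trans hgf
  -- Orthogonality of the two suprema is arranged by moving `e` and `g` into orthogonal copies `f₁`
  -- and `f₂` of `f`.
  have key : Equivalent (conj v e (hv e hef)) (conj w g (hw g hgf)) := by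
    refine equivalent_of_isLUB_of_orthogonal
      (fun i j hij => conj_mul_conj_eq_zero (hv _ (hpf i)) (hv _ (hpf j)) (hp hij))
      (fun i j hij => conj_mul_conj_eq_zero (hw _ (hqf i)) (hw _ (hqf j)) (hq hij))
      (isLUB_conj _ _ he) (isLUB_conj _ _ hg)
      (fun i => ((conj_equivalent _).trans (hpq i)).trans (conj_equivalent _).symm) ?_
    have h1 : star v * w = 0 := by
      rw [← val_mul_of_eq hv1, ← val_mul_of_eq hw1, star_mul, star_val, mul_assoc,
        ← mul_assoc f₁.val, h12, zero_mul, mul_zero]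
    calc _ = v * e.val * (star v * w) * g.val * star w := by simp only [conj_val, mul_assoc]
      _ = 0 := by rw [h1]; simp
  exact ((conj_equivalent _).symm.trans key).trans (conj_equivalent _)

/-! ### The Schröder–Bernstein theorem -/

theorem equivalent_of_le_of_subequivalent {f g : Proj A} (hgf : g ≤ f)
    (hfg : f.Subequivalent g) : Equivalent g f := by
  obtain ⟨f', hff', hf'g⟩ := hfg
  obtain ⟨v, hv1, hv2⟩ := hff'.symm
  have hv : ∀ x : Proj A, x ≤ f → star v * v * x.val = x.val := fun x hx => by
    rw [← hv2, le_iff_mul_left.1 hx]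
  have hvf : ∀ (x : Proj A) (hx : x ≤ f), conj v x (hv x hx) ≤ g := fun x hx => by
    refine le_trans (le_iff_mul_left.2 ?_) hf'g
    rw [conj_val, ← mul_assoc, ← mul_assoc, val_mul_of_eq hv1]
  let d := f.diff g hgf
  have hdg : d.val * g.val = 0 := diff_mul_self hgf
  -- The iterates of `d = f - g` under conjugation by `v`. With supremum `x` and `y = v x v*` one
  -- gets `x = d + y`, so `f = (f - x) + x ∼ (f - x) + y = g`. Here `v` alone gives `x ∼ y`, so no
  -- infinite additivity is needed.
  let s : ℕ → {x : Proj A // x ≤ f} :=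
    Nat.rec ⟨d, diff_le hgf⟩ fun _ x => ⟨conj v x.1 (hv x.1 x.2), (hvf x.1 x.2).trans hgf⟩
  obtain ⟨x, hx⟩ := exists_isLUB fun n => (s n).1
  have hxf : x ≤ f := hx.2 (by rintro _ ⟨n, rfl⟩; exact (s n).2)
  let y := conj v x (hv x hxf)
  have hy : IsLUB (Set.range fun n => (s (n + 1)).1) y :=
    isLUB_conj (fun n => hv _ (s n).2) (hv x hxf) hx
  have hyg : y ≤ g := hvf x hxf
  have hdy : d.val * y.val = 0 := mul_eq_zero_of_le hdg le_rfl hyg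
  have hdyx : d.add y hdy = x := by
    refine IsLUB.unique (a := d.add y hdy) (s := Set.range fun n => (s n).1)
      (isLUB_iff.2 ⟨fun n => ?_, fun a ha => ?_⟩) hx
    · rw [le_iff_mul_left, add_val, add_mul]
      cases n with
      | zero => exact (congrArg₂ (· + ·) d.mul_self (mul_eq_zero_comm.1 hdy)).trans (add_zero _)
      | succ n =>
        have h := hy.1 ⟨n, rfl⟩
        rw [le_iff_mul_left.1 h, mul_eq_zero_of_le hdy le_rfl h, zero_add]
    · rw [add_val, mul_add, (isLUB_iff.1 hy).2 a fun n => ha (n + 1), add_zero]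
      exact ha 0
  have hyx : y ≤ x := by
    rw [← hdyx, le_iff_mul_left, add_val, add_mul, hdy, mul_self, zero_add]
  have hxv : d.val + y.val = x.val := congrArg val hdyx
  have hcx : (f.diff x hxf).val * x.val = 0 := diff_mul_self hxf
  have hcy : (f.diff x hxf).val * y.val = 0 := mul_eq_zero_of_le hcx le_rfl hyx
  have h := (Equivalent.refl (f.diff x hxf)).add (conj_equivalent (hv x hxf)) hcy hcx
  have h1 : (f.diff x hxf).add y hcy = g := by
    ext
    rw [add_val, diff_val, ← hxv]
    change f.val - (f.val - g.val + y.val) + y.val = g.val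
    abel
  have h2 : (f.diff x hxf).add x hcx = f := by
    ext
    simp
  exact h2 ▸ h1 ▸ h

/-! ### Comparison of projections -/

/-- Projections `e`, `f` with `e A f ≠ 0` have nonzero equivalent subprojections. -/
theorem exists_equivalent_of_mul_ne_zero {e f : Proj A} {x : A} (hx : x ≠ 0)
    (hex : e.val * x = x) (hxf : x * f.val = x) :
    ∃ e' f' : Proj A, e' ≤ e ∧ f' ≤ f ∧ Equivalent e' f' ∧ f'.val ≠ 0 := by
  set c := star x * x with hc
  have hcsa : IsSelfAdjoint c := IsSelfAdjoint.star_mul_self x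
  have hc0 : 0 < ‖c‖ := by
    rw [norm_pos_iff, hc, Ne, CStarRing.star_mul_self_eq_zero_iff]
    exact hx
  set δ := ‖c‖ / 2 with hδ
  have hδ0 : 0 < δ := by positivity
  -- With `c = x*x`: `D = (c - δ)₊`, `K = (δ - c)₊` and `Y = max(c, δ)^(-1/2)`. On the support `p`
  -- of `D` one has `K = 0` and `Y²c = 1`, so `xYp` is a partial isometry with initial projection
  -- `p`.
  set D := cfc (fun t : ℝ => max (t - δ) 0) c with hD
  set K := cfc (fun t : ℝ => max (δ - t) 0) c with hK
  set Y := cfc (fun t : ℝ => (√(max t δ))⁻¹) c with hY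
  have hYcont : Continuous fun t : ℝ => (√(max t δ))⁻¹ := by
    refine Continuous.inv₀ (by fun_prop) fun t => ?_
    have : 0 < max t δ := lt_max_of_lt_right hδ0
    positivity
  have hD0 : D ≠ 0 := by
    -- If `D = 0` then `c = min(c, δ)` has norm at most `δ = ‖c‖ / 2`, which is absurd.
    intro h
    have h1 : cfc (fun t : ℝ => min t δ) c = c := by
      have h2 : cfc (fun t : ℝ => t - max (t - δ) 0) c = c := by
        rw [cfc_sub (fun t : ℝ => t) (fun t => max (t - δ) 0) c, ← hD, h, sub_zero, cfc_id' ℝ c]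
      refine Eq.trans (cfc_congr fun t _ => ?_) h2
      rcases le_total t δ with h | h <;> simp [h]
    have h2 : ‖cfc (fun t : ℝ => min t δ) c‖ ≤ δ := by
      refine norm_cfc_le hδ0.le fun t ht => ?_
      have : 0 ≤ t := spectrum_star_mul_self_nonneg t ht
      rw [Real.norm_of_nonneg (le_min this hδ0.le)]
      exact min_le_right _ _
    rw [h1] at h2
    linarith
  have hDK : D * K = 0 := by
    rw [hD, hK, ← cfc_mul (fun t : ℝ => max (t - δ) 0) (fun t => max (δ - t) 0) c]
    rw [← cfc_zero ℝ c]
    refine cfc_congr fun t _ => ?_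
    rcases le_total t δ with h | h <;> simp [h]
  have hYYc : Y * Y * c = 1 - δ⁻¹ • K := by
    have h1 : Y * Y * c = cfc (fun t : ℝ => (√(max t δ))⁻¹ * (√(max t δ))⁻¹ * t) c := by
      rw [cfc_mul (fun t : ℝ => (√(max t δ))⁻¹ * (√(max t δ))⁻¹) (fun t => t) c
        (hYcont.mul hYcont).continuousOn, cfc_mul (fun t : ℝ => (√(max t δ))⁻¹)
        (fun t => (√(max t δ))⁻¹) c hYcont.continuousOn hYcont.continuousOn, cfc_id' ℝ c]
    rw [h1, hK, ← cfc_const_mul δ⁻¹ (fun t : ℝ => max (δ - t) 0) c, ← cfc_one ℝ c,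
      ← cfc_sub (1 : ℝ → ℝ) (fun t : ℝ => δ⁻¹ * max (δ - t) 0) c (by fun_prop)]
    refine cfc_congr fun t _ => ?_
    have h2 : 0 < max t δ := lt_max_of_lt_right hδ0
    simp only [Pi.one_apply]
    rw [← mul_inv, Real.mul_self_sqrt h2.le]
    rcases le_total t δ with h | h
    · rw [max_eq_right h, max_eq_left (sub_nonneg.2 h)]
      field_simp
      ring
    · rw [max_eq_left h, max_eq_right (sub_nonpos.2 h)]
      have : t ≠ 0 := by linarith
      field_simp
      ring
  obtain ⟨q, hq⟩ := exists_annihilator {D}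
  simp only [Set.mem_singleton_iff, forall_eq] at hq
  have hcomm : ∀ b : A, IsSelfAdjoint b → Commute D b → q.val * b = b * q.val := fun b hb hDb => by
    have h1 : q.val * (b * q.val) = b * q.val := (hq _).1 (by
      rw [← mul_assoc, hDb.eq, mul_assoc, (hq _).2 q.mul_self, mul_zero])
    have h2 := congrArg star h1
    simp only [star_mul, star_val, hb.star_eq] at h2
    rw [← h2, mul_assoc, h1]
  have hYsa : IsSelfAdjoint Y := cfc_predicate _ _
  have hqY : q.val * Y = Y * q.val := hcomm Y hYsa (cfc_commute_cfc _ _ _)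
  have hqK : q.val * K = K := (hq K).1 hDK
  set p := q.compl with hp
  have hpY : p.val * Y = Y * p.val := by
    rw [hp, compl_val, sub_mul, mul_sub, one_mul, mul_one, hqY]
  have hpK : p.val * K = 0 := by rw [hp, compl_val, sub_mul, hqK, one_mul, sub_self]
  have hpp : p.val * (Y * Y * c) * p.val = p.val := by
    rw [hYYc, mul_sub, mul_smul_comm, hpK, smul_zero, sub_zero, mul_one, mul_self]
  have hp0 : p.val ≠ 0 := fun h => hD0 (by
    rw [hp, compl_val, sub_eq_zero] at h
    have := (hq 1).2 (by rw [← h, mul_one])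
    rwa [mul_one] at this)
  have hYc : Commute Y c := by
    have := cfc_commute_cfc (fun t : ℝ => (√(max t δ))⁻¹) (fun t => t) c
    rwa [cfc_id' ℝ c] at this
  have hfc : f.val * c = c := by
    rw [hc, ← mul_assoc]
    congr 1
    simpa using congrArg star hxf
  have hv : p.val = star (x * Y * p.val) * (x * Y * p.val) := by
    calc p.val = p.val * (Y * (Y * c)) * p.val := by rw [← mul_assoc Y, hpp]
      _ = p.val * (Y * (c * Y)) * p.val := by rw [hYc.eq]
      _ = _ := by simp only [hc, star_mul, star_val, hYsa.star_eq, mul_assoc]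
  obtain ⟨e', he', hequiv⟩ := exists_equivalent_of_star_mul_self hv
  refine ⟨e', p, ?_, ?_, hequiv, hp0⟩
  · rw [le_iff_mul_left, he']
    simp only [← mul_assoc, hex]
  · have h1 : Y * Y * c = c * (Y * Y) := (hYc.mul_left hYc).eq
    have h2 : f.val * p.val = p.val := by
      have h3 : (Y * Y * c) * p.val = p.val := by
        have h4 : K * p.val = 0 := by
          have hKsa : IsSelfAdjoint K := cfc_predicate _ _
          simpa [hKsa.star_eq] using congrArg star hpK
        rw [hYYc, sub_mul, smul_mul_assoc, h4, smul_zero, sub_zero, one_mul]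
      rw [← h3, h1, ← mul_assoc, ← mul_assoc, hfc]
    exact le_iff_mul_left.2 h2

/-- Projections `e`, `f` with `e A f = 0` are separated by a central projection. -/
theorem exists_isCentral_of_mul_eq_zero {e f : Proj A} (h : ∀ a : A, e.val * a * f.val = 0) :
    ∃ z : Proj A, z.IsCentral ∧ e ≤ z ∧ f ≤ z.compl := by
  refine ⟨e.centralCover, e.isLeast_centralCover.1.1, e.isLeast_centralCover.1.2, ?_⟩
  -- The annihilator of `eA` is stable under left multiplication, so its generator `q` is central;
  -- it dominates `f` and is orthogonal to the central cover of `e`.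
  obtain ⟨q, hq⟩ := exists_annihilator (Set.range fun a : A => e.val * a)
  simp only [Set.forall_mem_range] at hq
  have h1 : ∀ a : A, q.val * (a * q.val) = a * q.val := fun a => (hq _).1 fun b => by
    rw [← mul_assoc, mul_assoc e.val]
    exact (hq _).2 q.mul_self _
  have hqc : q.IsCentral := fun a => by
    have h2 := congrArg star (h1 (star a))
    simp only [star_mul, star_val, star_star] at h2
    rw [← h2, mul_assoc, h1]
  have heq : e ≤ q.compl := by
    rw [le_compl_iff, mul_eq_zero_comm]
    simpa using (hq _).2 q.mul_self 1
  have h3 := e.isLeast_centralCover.2 ⟨hqc.compl, heq⟩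
  rw [le_compl_iff] at h3 ⊢
  exact mul_eq_zero_of_le (mul_eq_zero_comm.1 h3) le_rfl (le_iff_mul_left.2 ((hq _).1 h))

end Proj

/-- There is a maximal subset of `S` consisting of pairwise `r`-related elements. -/
theorem exists_maximal_pairwise {α : Type*} (S : Set α) (r : α → α → Prop)
    (hr : ∀ x y, r x y → r y x) :
    ∃ T ⊆ S, T.Pairwise r ∧ ∀ x ∈ S, (∀ y ∈ T, r x y) → x ∈ T := by
  obtain ⟨T, hT⟩ := zorn_subset {T : Set α | T ⊆ S ∧ T.Pairwise r} fun c hc hchain =>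
    ⟨⋃₀ c, ⟨Set.sUnion_subset fun t ht => (hc ht).1,
      (Set.pairwise_sUnion hchain.directedOn).2 fun t ht => (hc ht).2⟩,
      fun t ht => Set.subset_sUnion_of_mem ht⟩
  refine ⟨T, hT.prop.1, hT.prop.2, fun x hx hxT => ?_⟩
  refine hT.le_of_ge (y := insert x T) ⟨Set.insert_subset hx hT.prop.1, ?_⟩
    (Set.subset_insert x T) (Set.mem_insert x T)
  exact hT.prop.2.insert fun y hy _ => ⟨hxT y hy, hr _ _ (hxT y hy)⟩

namespace Proj

variable {A : Type u} [CStarAlgebra A] [IsAWStarAlgebra A]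

/-- Generalized comparability below a properly infinite projection. -/
theorem exists_isCentral_subequivalent {f g h : Proj A} (hf : f.ProperlyInfinite)
    (hg : g ≤ f) (hh : h ≤ f) : ∃ (z : Proj A) (hz : z.IsCentral),
      (z.cut hz g).Subequivalent h ∧ (z.compl.cut hz.compl h).Subequivalent g := by
  obtain ⟨T, hTS, hTp, hTm⟩ := exists_maximal_pairwise
    {x : Proj A × Proj A | x.1 ≤ g ∧ x.2 ≤ h ∧ Equivalent x.1 x.2}
    (fun x y => x.1.val * y.1.val = 0 ∧ x.2.val * y.2.val = 0)
    (fun x y hxy => ⟨mul_eq_zero_comm.1 hxy.1, mul_eq_zero_comm.1 hxy.2⟩)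
  obtain ⟨g', hg'⟩ := exists_isLUB fun x : T => x.1.1
  obtain ⟨h', hh'⟩ := exists_isLUB fun x : T => x.1.2
  have hg'g : g' ≤ g := hg'.2 (by rintro _ ⟨x, rfl⟩; exact (hTS x.2).1)
  have hh'h : h' ≤ h := hh'.2 (by rintro _ ⟨x, rfl⟩; exact (hTS x.2).2.1)
  have hequiv : Equivalent g' h' := equivalent_of_isLUB hf (hg'g.trans hg) (hh'h.trans hh)
    (fun x y hxy => (hTp x.2 y.2 fun h => hxy (Subtype.ext h)).1)
    (fun x y hxy => (hTp x.2 y.2 fun h => hxy (Subtype.ext h)).2) hg' hh'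
    fun x => (hTS x.2).2.2
  -- Otherwise the remainders contain a nonzero equivalent pair, which would enlarge the maximal
  -- family.
  have hzero : ∀ a : A, (h.diff h' hh'h).val * a * (g.diff g' hg'g).val = 0 := fun a => by
    by_contra ha
    obtain ⟨y, x, hy, hx, hyx, hx0⟩ := exists_equivalent_of_mul_ne_zero
      (e := h.diff h' hh'h) (f := g.diff g' hg'g) ha (by rw [← mul_assoc, mul_self_assoc])
      (by rw [mul_assoc, mul_self])
    have hmem : (x, y) ∈ T := hTm _
      ⟨hx.trans (diff_le _), hy.trans (diff_le _), hyx.symm⟩ fun t ht =>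
        ⟨mul_eq_zero_of_le (diff_mul_self hg'g) hx (hg'.1 ⟨⟨t, ht⟩, rfl⟩),
          mul_eq_zero_of_le (diff_mul_self hh'h) hy (hh'.1 ⟨⟨t, ht⟩, rfl⟩)⟩
    apply hx0
    rw [← mul_self]
    exact mul_eq_zero_of_le (diff_mul_self hg'g) hx (hg'.1 ⟨⟨_, hmem⟩, rfl⟩)
  obtain ⟨z, hz, hhz, hgz⟩ := exists_isCentral_of_mul_eq_zero hzero
  rw [le_compl_iff, diff_val, mul_sub, sub_eq_zero] at hgz
  rw [le_iff_mul_left, diff_val, mul_sub, ← sub_eq_zero] at hhz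
  refine ⟨z, hz, ⟨z.cut hz h', ?_, (cut_le hz h').trans hh'h⟩,
    ⟨z.compl.cut hz.compl g', ?_, (cut_le hz.compl g').trans hg'g⟩⟩
  · have : z.cut hz g = z.cut hz g' := by ext; exact hgz
    rw [this]
    exact hequiv.cut hz
  · have : z.compl.cut hz.compl h = z.compl.cut hz.compl h' := by
      ext
      rw [cut_val, cut_val, compl_val, sub_mul, sub_mul, one_mul, one_mul, ← sub_eq_zero,
        ← neg_eq_zero, ← hhz]
      abel
    rw [this]
    exact hequiv.symm.cut hz.compl

/-! ### Divisible projections -/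

variable {I : Type u}

theorem Divisible.of_equivalent {e e' : Proj A} (h : Divisible I e) (hee' : Equivalent e e') :
    Divisible I e' := by
  obtain ⟨p, hp⟩ := h
  obtain ⟨v, hv1, hv2⟩ := hee'.symm
  have hv : ∀ x : Proj A, x ≤ e → star v * v * x.val = x.val := fun x hx => by
    rw [← hv2, le_iff_mul_left.1 hx]
  have hpe : ∀ i, p i ≤ e := fun i => hp.isLUB.1 ⟨i, rfl⟩
  have he : conj v e (hv e le_rfl) = e' := by
    ext
    rw [conj_val, mul_val_of_eq hv2, ← hv1]
  refine ⟨fun i => conj v (p i) (hv _ (hpe i)),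
    fun i j hij => conj_mul_conj_eq_zero _ _ (hp.orthogonal i j hij), ?_,
    fun i => ((conj_equivalent _).trans (hp.equivalent i)).trans hee'⟩
  rw [← he]
  exact isLUB_conj _ _ hp.isLUB

theorem Divisible.cut {e z : Proj A} (h : Divisible I e) (hz : z.IsCentral) :
    Divisible I (z.cut hz e) := by
  obtain ⟨p, hp⟩ := h
  exact ⟨fun i => z.cut hz (p i),
    fun i j hij => mul_eq_zero_of_le (hp.orthogonal i j hij) (cut_le hz _) (cut_le hz _),
    isLUB_cut hz hp.isLUB, fun i => (hp.equivalent i).cut hz⟩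

theorem Divisible.of_isLUB {f : Proj A} (hf : f.ProperlyInfinite) {κ : Type*} {t : κ → Proj A}
    (ht : Pairwise fun k l => (t k).val * (t l).val = 0) (hdiv : ∀ k, Divisible I (t k))
    {g : Proj A} (hg : IsLUB (Set.range t) g) (hgf : g ≤ f) : Divisible I g := by
  choose p hp using hdiv
  have hpt : ∀ k i, p k i ≤ t k := fun k i => (hp k).isLUB.1 ⟨i, rfl⟩
  have htg : ∀ k, t k ≤ g := fun k => hg.1 ⟨k, rfl⟩
  -- Regroup the array `p k i` by columns: each `G i` is a sum over `k` of copies of the `t k`,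
  -- hence a copy of `g`.
  choose G hG using fun i => exists_isLUB fun k => p k i
  have hGg : ∀ i, G i ≤ g := fun i => (hG i).2 (by
    rintro _ ⟨k, rfl⟩
    exact (hpt k i).trans (htg k))
  refine ⟨G, fun i j hij => mul_eq_zero_of_isLUB (hG i) (hG j) fun k l => ?_, ⟨?_, fun b hb => ?_⟩,
    fun i => equivalent_of_isLUB hf ((hGg i).trans hgf) hgf
      (fun k l hkl => mul_eq_zero_of_le (ht hkl) (hpt k i) (hpt l i)) ht (hG i) hg
      fun k => (hp k).equivalent i⟩
  · by_cases hkl : k = l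
    · subst hkl
      exact (hp k).orthogonal i j hij
    · exact mul_eq_zero_of_le (ht hkl) (hpt k i) (hpt l j)
  · rintro _ ⟨i, rfl⟩
    exact hGg i
  · refine hg.2 ?_
    rintro _ ⟨k, rfl⟩
    refine (hp k).isLUB.2 ?_
    rintro _ ⟨i, rfl⟩
    exact ((hG i).1 ⟨k, rfl⟩).trans (hb ⟨i, rfl⟩)

/-- A divisible projection absorbs an orthogonal projection subequivalent to it. -/
theorem Divisible.equivalent_of_diff_subequivalent [Nontrivial I] {f g : Proj A}
    (hdiv : Divisible I g) (hgf : g ≤ f) (h : (f.diff g hgf).Subequivalent g) :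
    Equivalent g f := by
  refine equivalent_of_le_of_subequivalent hgf ?_
  obtain ⟨p, hp⟩ := hdiv
  obtain ⟨i, j, hij⟩ := exists_pair_ne I
  obtain ⟨k, hk, hkg⟩ := h
  obtain ⟨v, hv1, hv2⟩ := hp.equivalent j
  have hkv : star v * v * k.val = k.val := by rw [← hv2, le_iff_mul_left.1 hkg]
  have hkj : conj v k hkv ≤ p j := by
    rw [le_iff_mul_left, conj_val, ← mul_assoc, ← mul_assoc, val_mul_of_eq hv1]
  have horth : (p i).val * (conj v k hkv).val = 0 :=
    mul_eq_zero_of_le (hp.orthogonal i j hij) le_rfl hkj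
  have hgd : g.val * (f.diff g hgf).val = 0 := mul_eq_zero_comm.1 (diff_mul_self hgf)
  have hfg : g.add (f.diff g hgf) hgd = f := by ext; simp
  -- `p i` houses a copy of `g` and `p j` a copy of `f - g`; together they form a copy of `f` below
  -- `g`.
  refine ⟨(p i).add (conj v k hkv) horth, ?_, ?_⟩
  · have := (hp.equivalent i).symm.add (hk.trans (conj_equivalent hkv).symm) hgd horth
    rwa [hfg] at this
  · rw [le_iff_mul_left, add_val, mul_add, le_iff_mul_left.1 (hp.isLUB.1 ⟨i, rfl⟩),
      le_iff_mul_left.1 (hkj.trans (hp.isLUB.1 ⟨j, rfl⟩))]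

/-- Divisibility passes from a subprojection with the same central cover to a properly infinite
projection. -/
theorem Divisible.of_le [Nontrivial I] {e f : Proj A} (hf : f.ProperlyInfinite) (hef : e ≤ f)
    (hdiv : Divisible I e)
    (hcover : ∀ z : Proj A, z.IsCentral → z.val * e.val = 0 → z.val * f.val = 0) :
    Divisible I f := by
  obtain ⟨T, hTS, hTp, hTm⟩ := exists_maximal_pairwise
    {x : Proj A | x ≤ f ∧ Divisible I x} (fun x y => x.val * y.val = 0)
    (fun _ _ => mul_eq_zero_comm.1)
  obtain ⟨g, hg⟩ := exists_isLUB fun x : T => x.1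
  have hTg : ∀ x ∈ T, x ≤ g := fun x hx => hg.1 ⟨⟨x, hx⟩, rfl⟩
  have hgf : g ≤ f := hg.2 (by rintro _ ⟨x, rfl⟩; exact (hTS x.2).1)
  have hgdiv : Divisible I g := Divisible.of_isLUB hf
    (fun x y hxy => hTp x.2 y.2 fun h => hxy (Subtype.ext h)) (fun x => (hTS x.2).2) hg hgf
  have hmax : ∀ x : Proj A, x ≤ f → Divisible I x → x.val * g.val = 0 → x.val = 0 :=
    fun x hxf hx hxg => by
      have := hTm x ⟨hxf, hx⟩ fun y hy => mul_eq_zero_of_le hxg le_rfl (hTg y hy)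
      rw [← mul_self]
      exact mul_eq_zero_of_le hxg le_rfl (hTg x this)
  obtain ⟨z, hz, ⟨k, hk, hkd⟩, hsub⟩ :=
    exists_isCentral_subequivalent hf hgf (diff_le hgf)
  have hk0 : k.val = 0 := hmax k (hkd.trans (diff_le hgf)) ((hgdiv.cut hz).of_equivalent hk)
    (mul_eq_zero_of_le (diff_mul_self hgf) hkd le_rfl)
  have hzg : z.val * g.val = 0 := hk.symm.val_eq_zero hk0
  have hze : z.val * e.val = 0 := by
    refine hmax (z.cut hz e) ((cut_le hz e).trans hef) (hdiv.cut hz) ?_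
    rw [cut_val, hz e.val, mul_assoc, hzg, mul_zero]
  have hzf := hcover z hz hze
  have hd : z.compl.cut hz.compl (f.diff g hgf) = f.diff g hgf := by
    ext
    simp [sub_mul, mul_sub, hzg, hzf]
  rw [hd] at hsub
  exact hgdiv.of_equivalent (hgdiv.equivalent_of_diff_subequivalent hgf hsub)

/-- A central `z` killing `e'` also kills the equivalent `e`, so `1 - z` dominates the common
central cover and hence `f`. -/
theorem mul_eq_zero_of_centralCover_eq {e e' f : Proj A} (hcover : e.centralCover = f.centralCover)
    (hee' : Equivalent e e') {z : Proj A} (hz : z.IsCentral) (h : z.val * e'.val = 0) :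
    z.val * f.val = 0 := by
  have h1 : z.val * e.val = 0 := (hee'.symm.cut hz).val_eq_zero h
  have h2 := e.isLeast_centralCover.2 ⟨hz.compl, le_compl_iff.2 h1⟩
  rw [hcover] at h2
  exact le_compl_iff.1 (f.isLeast_centralCover.1.2.trans h2)

end Proj

end AWStar

theorem theorem4p6 {A : Type u} [CStarAlgebra A] [AWStar.IsAWStarAlgebra A]
    (e f : AWStar.Proj A) (he : e.ProperlyInfinite) (hf : f.ProperlyInfinite)
    (hcover : e.centralCover = f.centralCover) (hef : e.Subequivalent f) :
    e.dim ≤ f.dim := by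
  refine (e.isLeast_dim he.1).2 ?_
  rintro _ ⟨I, p, hp, rfl⟩
  suffices h : AWStar.Proj.Divisible I f by
    obtain ⟨q, hq⟩ := h
    exact (f.isLeast_dim hf.1).1 _ ⟨I, q, hq, rfl⟩
  rcases subsingleton_or_nontrivial I with hI | hI
  · have hne : Nonempty I := by
      by_contra hI'
      rw [not_nonempty_iff] at hI'
      -- The supremum of the empty family is killed by `1`, so `e` would be zero.
      have := (AWStar.Proj.isLUB_iff.1 hp.isLUB).2 1 isEmptyElim
      exact he.1 (by rwa [one_mul] at this)
    exact AWStar.Proj.divisible_of_subsingleton f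
  · obtain ⟨e', hee', he'f⟩ := hef
    exact AWStar.Proj.Divisible.of_le hf he'f (AWStar.Proj.Divisible.of_equivalent ⟨p, hp⟩ hee')
      fun z hz => AWStar.Proj.mul_eq_zero_of_centralCover_eq hcover hee' hz
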